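/- Let $n,N\ge 2$, let $X\subset\mathbb R^n$ be compact, let $y_1,\dots,y_N\in\mathbb R^n$ be distinct, and let $c$ be a real-valued cost on $X\times\{y_1,\dots,y_N\}$ such that - $c(\cdot,y_i)\in C^2(X)$ for every $i$; - $\nabla_xc(x,y_i)\ne\nabla_xc(x,y_k)$ for all $x\in X$ and $i\ne k$ (twist condition); - for every $i$ there are a convex set $Y_i\subset\mathbb R^n$ and a $C^2$ diffeomorphism $\exp_i:Y_i\to X$ such that $\{p\in Y_i : -c(\exp_i(p),y_k)+c(\exp_i(p),y_i)\le t\}$ is convex for all $k$ and all $t\in\mathbb R$ (Loeper's condition), and $\exp_i^{-1}(X)$ is convex ($c$-convexity of $X$). Let $\mu=\rho\,dx$ be a probability measure on $X$ whose density $\rho\ge 0$ is $\alpha$-Hölder continuous on $X$ for some $0<\alpha\le 1$, and let $\lambda\in[0,1]^N$ with $\sum_i\lambda^i=1$. All norms on $\mathbb R^N$ are Euclidean. For $\psi\in\mathbb R^N$ let $$G^i(\psi)=\mu\bigl(\{x\in X : c(x,y_i)+\psi^i=\min_j (c(x,y_j)+\psi^j)\}\bigr),\qquad G=(G^1,\dots,G^N),$$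 $$\Phi(\psi)=\int_X\min_i\bigl(c(x,y_i)+\psi^i\bigr)\,d\mu-\langle\psi,\lambda\rangle,\qquad \tilde\Phi(\psi)=\Phi(\psi)-\frac{\gamma}{2}\|\psi\|^2,$$ $$M_0=\sqrt N\,\max_{x\in X}\Bigl(\max_i c(x,y_i)-\min_i c(x,y_i)\Bigr).$$ Suppose that $0<\gamma<\frac{\min_i\lambda^i}{M_0}$. Then $G:\mathbb R^N\to\mathbb R^N$ is Lipschitz, $\tilde\Phi$ is differentiable, and $\tilde\Phi$ has a unique maximizer $\psi^*$. Moreover, let $C_L$ be a Lipschitz constant of $G$ (for instance the least one), and put $Q_f=\frac{C_L+\gamma}{\gamma}$ and $h=\frac{2}{C_L+2\gamma}$. For every $\psi_0\in\mathbb R^N$ the iterates $\psi_{k+1}=\psi_k+h\nabla\tilde\Phi(\psi_k)$ of gradient ascent satisfy, for all $k\ge 0$, $$\|\psi_k-\psi^*\|\le\Bigl(\frac{Q_f-1}{Q_f+1}\Bigr)^k(M_0+\|\psi_0\|),$$ $$\|\nabla\tilde\Phi(\psi_k)\|\le(C_L+\gamma)\Bigl(\frac{Q_f-1}{Q_f+1}\Bigr)^k(M_0+\|\psi_0\|).$$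 -/

import Mathlib

open MeasureTheory Set
open scoped NNReal Gradient

noncomputable section

namespace SemiDiscreteOT

variable {n N : ℕ}

/-- `C²` regularity on `X` of each of the functions `c(·, y_i)`. -/
def CostRegular (X : Set (EuclideanSpace ℝ (Fin n)))
    (c : EuclideanSpace ℝ (Fin n) → EuclideanSpace ℝ (Fin n) → ℝ)
    (y : Fin N → EuclideanSpace ℝ (Fin n)) : Prop :=
  ∀ i, ContDiffOn ℝ 2 (fun x => c x (y i)) X

/-- The twist condition: `∇ₓ c(x, y_i) ≠ ∇ₓ c(x, y_k)` for all `x ∈ X` and `i ≠ k`. The cost is a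
function on `X`, so the gradient is taken within `X`. -/
def CostTwist (X : Set (EuclideanSpace ℝ (Fin n)))
    (c : EuclideanSpace ℝ (Fin n) → EuclideanSpace ℝ (Fin n) → ℝ)
    (y : Fin N → EuclideanSpace ℝ (Fin n)) : Prop :=
  ∀ x ∈ X, ∀ i k, i ≠ k →
    gradientWithin (fun z => c z (y i)) X x ≠ gradientWithin (fun z => c z (y k)) X x

/-- The data in Loeper's condition for the index `i`: a convex set `Y_i` (`dom`) and a `C²`
diffeomorphism `exp_i : Y_i → X` (`exp`, with inverse `inv`) such that all the sublevel sets
`{p ∈ Y_i | -c(exp_i p, y_k) + c(exp_i p, y_i) ≤ t}` are convex. -/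
structure LoeperChart (X : Set (EuclideanSpace ℝ (Fin n)))
    (c : EuclideanSpace ℝ (Fin n) → EuclideanSpace ℝ (Fin n) → ℝ)
    (y : Fin N → EuclideanSpace ℝ (Fin n)) (i : Fin N) where
  dom : Set (EuclideanSpace ℝ (Fin n))
  exp : EuclideanSpace ℝ (Fin n) → EuclideanSpace ℝ (Fin n)
  inv : EuclideanSpace ℝ (Fin n) → EuclideanSpace ℝ (Fin n)
  convex_dom : Convex ℝ dom
  mapsTo_exp : MapsTo exp dom X
  mapsTo_inv : MapsTo inv X dom
  invOn : InvOn inv exp dom X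
  contDiffOn_exp : ContDiffOn ℝ 2 exp dom
  contDiffOn_inv : ContDiffOn ℝ 2 inv X
  quasiconvex : ∀ (t : ℝ) (k : Fin N),
    Convex ℝ {p | p ∈ dom ∧ -c (exp p) (y k) + c (exp p) (y i) ≤ t}

/-- `X` is `c`-convex with respect to `Y`: each `exp_i⁻¹(X)` is convex. -/
def CConvex {X : Set (EuclideanSpace ℝ (Fin n))}
    {c : EuclideanSpace ℝ (Fin n) → EuclideanSpace ℝ (Fin n) → ℝ}
    {y : Fin N → EuclideanSpace ℝ (Fin n)} (L : ∀ i, LoeperChart X c y i) : Prop :=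
  ∀ i, Convex ℝ {p | p ∈ (L i).dom ∧ (L i).exp p ∈ X}

/-- The `i`-th Laguerre cell of `ψ`. -/
def laguerreCell (X : Set (EuclideanSpace ℝ (Fin n)))
    (c : EuclideanSpace ℝ (Fin n) → EuclideanSpace ℝ (Fin n) → ℝ)
    (y : Fin N → EuclideanSpace ℝ (Fin n)) (ψ : EuclideanSpace ℝ (Fin N)) (i : Fin N) :
    Set (EuclideanSpace ℝ (Fin n)) :=
  {x | x ∈ X ∧ c x (y i) + ψ i = ⨅ j, (c x (y j) + ψ j)}

/-- `G(ψ) = (μ(Lag_1(ψ)), …, μ(Lag_N(ψ)))`, with values in Euclidean space. -/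
def cellMass (X : Set (EuclideanSpace ℝ (Fin n)))
    (c : EuclideanSpace ℝ (Fin n) → EuclideanSpace ℝ (Fin n) → ℝ)
    (y : Fin N → EuclideanSpace ℝ (Fin n)) (μ : Measure (EuclideanSpace ℝ (Fin n)))
    (ψ : EuclideanSpace ℝ (Fin N)) : EuclideanSpace ℝ (Fin N) :=
  WithLp.toLp 2 fun i => μ.real (laguerreCell X c y ψ i)

/-- Kantorovich's functional `Φ(ψ) = ∫_X min_i (c(x, y_i) + ψ^i) dμ - ⟨ψ, w⟩`. -/
def kantorovich (X : Set (EuclideanSpace ℝ (Fin n)))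
    (c : EuclideanSpace ℝ (Fin n) → EuclideanSpace ℝ (Fin n) → ℝ)
    (y : Fin N → EuclideanSpace ℝ (Fin n)) (μ : Measure (EuclideanSpace ℝ (Fin n)))
    (w : EuclideanSpace ℝ (Fin N)) (ψ : EuclideanSpace ℝ (Fin N)) : ℝ :=
  (∫ x in X, (⨅ i, (c x (y i) + ψ i)) ∂μ) - inner ℝ ψ w

/-- The regularized functional `Φ(ψ) - (γ / 2) ‖ψ‖²`. -/
def regKantorovich (X : Set (EuclideanSpace ℝ (Fin n)))
    (c : EuclideanSpace ℝ (Fin n) → EuclideanSpace ℝ (Fin n) → ℝ)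
    (y : Fin N → EuclideanSpace ℝ (Fin n)) (μ : Measure (EuclideanSpace ℝ (Fin n)))
    (w : EuclideanSpace ℝ (Fin N)) (γ : ℝ) (ψ : EuclideanSpace ℝ (Fin N)) : ℝ :=
  kantorovich X c y μ w ψ - γ / 2 * ‖ψ‖ ^ 2

/-- `M₀ = √N · max_{x ∈ X} (max_i c(x, y_i) - min_i c(x, y_i))`. -/
def oscBound (X : Set (EuclideanSpace ℝ (Fin n)))
    (c : EuclideanSpace ℝ (Fin n) → EuclideanSpace ℝ (Fin n) → ℝ)
    (y : Fin N → EuclideanSpace ℝ (Fin n)) : ℝ :=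
  √(N : ℝ) * ⨆ x : X, ((⨆ i, c x (y i)) - ⨅ i, c x (y i))

/-- The iterates of gradient ascent on `f` with constant step size `h`, started at `ψ₀`. -/
def gradientAscent (f : EuclideanSpace ℝ (Fin N) → ℝ) (h : ℝ) (ψ₀ : EuclideanSpace ℝ (Fin N)) :
    ℕ → EuclideanSpace ℝ (Fin N)
  | 0 => ψ₀
  | k + 1 => gradientAscent f h ψ₀ k + h • ∇ f (gradientAscent f h ψ₀ k)

end SemiDiscreteOT

end

/-! `kantorovich` is concave with supergradient `cellMass - w`: the index attaining the minimum for
ψ is a competitor for any φ. Everything else rests on `cellMass` being Lipschitz. A point that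
changes cell between ψ and φ lies in a slab of some cost difference, of width at most 2‖ψ - φ‖
(`abs_cellMass_sub_le`), and slabs have mass O(width) (`exists_slabBound`): in the chart `exp` the
domain is convex, and twist makes the cost difference free of critical points.

A concave function with C-Lipschitz supergradient is differentiable and its gradient is cocoercive.
Hence an ascent step for the γ-regularized functional with h = 2/(C + 2γ) contracts by C/(C + 2γ)
(`norm_ascent_step_sub_le`). Its fixed point is the critical point, and quadratic growth makes it
the unique maximizer. The critical equation gives ‖ψ*‖ ≤ M₀ (`norm_le_oscBound`), which bounds the
initial error. -/

namespace SemiDiscreteOT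

/-! ### Volume of slabs between level sets. -/

section LevelSlabs

open Filter Topology

theorem measurableSet_inter_preimage_Ioc {E : Type*} [TopologicalSpace E] [MeasurableSpace E]
    [BorelSpace E] {D : Set E} (hD : IsClosed D) {g : E → ℝ} (hg : ContinuousOn g D) (s t : ℝ) :
    MeasurableSet (D ∩ g ⁻¹' Ioc s t) := by
  have h : D ∩ g ⁻¹' Ioc s t = (D ∩ g ⁻¹' Iic t) \ (D ∩ g ⁻¹' Iic s) := by
    ext p
    simp only [mem_inter_iff, mem_preimage, mem_Ioc, mem_Iic, Set.mem_sdiff]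
    grind
  rw [h]
  exact (hg.preimage_isClosed_of_isClosed hD isClosed_Iic).measurableSet.diff
    (hg.preimage_isClosed_of_isClosed hD isClosed_Iic).measurableSet

variable {E : Type*} [NormedAddCommGroup E] [NormedSpace ℝ E]
  [MeasurableSpace E] [BorelSpace E] (ν : Measure E) [ν.IsAddHaarMeasure]

/-- A set whose chords in the direction `e` have length at most `ℓ` has volume `O(ℓ)`:
its translates by multiples of `2 ℓ e` are disjoint. -/
theorem measure_le_of_chord_le {A : Set E} (hA : MeasurableSet A) {p₀ e : E} {r ℓ : ℝ}
    (hr : A ⊆ Metric.ball p₀ r) (hℓ : 0 < ℓ)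
    (h : ∀ p ∈ A, ∀ τ : ℝ, p + τ • e ∈ A → |τ| ≤ ℓ) :
    ν A ≤ ENNReal.ofReal (4 * ℓ) * ν (Metric.ball p₀ (r + ‖e‖)) := by
  set V := ν (Metric.ball p₀ (r + ‖e‖))
  rcases lt_or_ge (1 : ℝ) (4 * ℓ) with h4 | h4
  · calc ν A ≤ V := measure_mono (hr.trans (Metric.ball_subset_ball (by simp)))
      _ ≤ ENNReal.ofReal (4 * ℓ) * V := by
        refine le_mul_of_one_le_left (zero_le) ?_
        rw [← ENNReal.ofReal_one]
        exact ENNReal.ofReal_le_ofReal h4.le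
  -- As 2ℓm ≤ 1, the m translates move by at most ‖e‖; as ℓ ≤ 1/4, rounding down still leaves 4ℓm ≥
  -- 1.
  set m : ℕ := ⌊1 / (2 * ℓ)⌋₊
  have hm : (m : ℝ) ≤ 1 / (2 * ℓ) := Nat.floor_le (by positivity)
  have hm' : 1 / (2 * ℓ) < m + 1 := Nat.lt_floor_add_one _
  have h2 : 2 ≤ 1 / (2 * ℓ) := by
    rw [le_div_iff₀ (by positivity)]; linarith
  have hm4 : 1 ≤ 4 * ℓ * m := by
    have h3 : 1 / (4 * ℓ) ≤ m := by
      have : 1 / (2 * ℓ) = 2 * (1 / (4 * ℓ)) := by field_simp; norm_num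
      linarith
    rw [div_le_iff₀ (by positivity)] at h3
    linarith
  let B : ℕ → Set E := fun k => (fun p => p + (2 * ℓ * k) • e) ⁻¹' A
  have hB : ∀ k, ν (B k) = ν A := fun k => measure_preimage_add_right ν _ A
  have hdisj : Set.PairwiseDisjoint (↑(Finset.range m)) B := by
    intro i _ j _ hij
    rw [Function.onFun, Set.disjoint_left]
    intro p hp hq
    have hτ := h _ hp (2 * ℓ * j - 2 * ℓ * i) (by
      have : p + (2 * ℓ * i : ℝ) • e + (2 * ℓ * j - 2 * ℓ * i : ℝ) • e
        = p + (2 * ℓ * j : ℝ) • e := by module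
      rw [this]; exact hq)
    have hij' : (1 : ℝ) ≤ |(j : ℝ) - i| := by
      have : (j : ℤ) - i ≠ 0 := by omega
      have := Int.one_le_abs this
      exact_mod_cast this
    rw [← mul_sub, abs_mul, abs_of_pos (by positivity)] at hτ
    nlinarith
  have hmeas : ∀ k ∈ Finset.range m, MeasurableSet (B k) := fun k _ =>
    (measurable_add_const _) hA
  have hsub : (⋃ k ∈ Finset.range m, B k) ⊆ Metric.ball p₀ (r + ‖e‖) := by
    intro p hp
    simp only [Finset.mem_range, mem_iUnion] at hp
    obtain ⟨k, hk, hp⟩ := hp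
    have h1 : dist (p + (2 * ℓ * k : ℝ) • e) p₀ < r := hr hp
    have h3 : dist p (p + (2 * ℓ * k : ℝ) • e) ≤ ‖e‖ := by
      rw [dist_self_add_right, norm_smul, Real.norm_of_nonneg (by positivity)]
      refine mul_le_of_le_one_left (norm_nonneg _) ?_
      have : (k : ℝ) ≤ 1 / (2 * ℓ) := le_trans (by exact_mod_cast hk.le) hm
      rw [le_div_iff₀ (by positivity)] at this
      linarith
    rw [Metric.mem_ball]
    linarith [dist_triangle p (p + (2 * ℓ * k : ℝ) • e) p₀]
  have hsum : (m : ENNReal) * ν A ≤ V := by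
    calc (m : ENNReal) * ν A = ∑ k ∈ Finset.range m, ν (B k) := by simp [hB]
      _ = ν (⋃ k ∈ Finset.range m, B k) := (measure_biUnion_finset hdisj hmeas).symm
      _ ≤ V := measure_mono hsub
  calc ν A ≤ ENNReal.ofReal (4 * ℓ * m) * ν A := by
        refine le_mul_of_one_le_left (zero_le) ?_
        rw [← ENNReal.ofReal_one]
        exact ENNReal.ofReal_le_ofReal hm4
    _ = ENNReal.ofReal (4 * ℓ) * (m * ν A) := by
        rw [ENNReal.ofReal_mul (by positivity), ENNReal.ofReal_natCast, mul_assoc]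
    _ ≤ _ := by gcongr

variable [FiniteDimensional ℝ E]

/-- Near `p₀` the derivative of g along some e exceeds δ/2. By the mean value theorem on segments,
available since D and the ball are convex, chords of the slab along e have length at most 2(t -
s)/δ, so the chord bound applies. -/
theorem exists_nhdsWithin_measure_slab_le {D : Set E} (hD : Convex ℝ D) (hDc : IsClosed D)
    {g : E → ℝ} {g' : E → E →L[ℝ] ℝ} (hg : ∀ p ∈ D, HasFDerivWithinAt g (g' p) D p)
    (hg' : ContinuousOn g' D) {p₀ : E} (hp₀ : p₀ ∈ D) (h0 : g' p₀ ≠ 0) :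
    ∃ U ∈ 𝓝[D] p₀, ∃ C : ℝ≥0, ∀ s t : ℝ, s < t →
      ν (U ∩ (D ∩ g ⁻¹' Ioc s t)) ≤ C * ENNReal.ofReal (t - s) := by
  obtain ⟨e, he⟩ : ∃ e, 0 < g' p₀ e := by
    obtain ⟨e, he⟩ := DFunLike.ne_iff.1 h0
    rcases lt_or_gt_of_ne he with h | h
    · exact ⟨-e, by simpa using h⟩
    · exact ⟨e, h⟩
  set δ := g' p₀ e
  have hev : ∀ᶠ p in 𝓝[D] p₀, δ / 2 < g' p e := by
    have : ContinuousWithinAt (fun p => g' p e) D p₀ := (hg' p₀ hp₀).clm_apply continuousWithinAt_const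
    exact this.eventually (lt_mem_nhds (half_lt_self he))
  obtain ⟨r, hr, hball⟩ := Metric.mem_nhdsWithin_iff.1 hev
  refine ⟨Metric.ball p₀ r, mem_nhdsWithin_of_mem_nhds (Metric.ball_mem_nhds _ hr),
    (8 / δ).toNNReal * (ν (Metric.ball p₀ (r + ‖e‖))).toNNReal, fun s t hst => ?_⟩
  have hgc : ContinuousOn g D := fun p hp => (hg p hp).continuousWithinAt
  have hmeas : MeasurableSet (Metric.ball p₀ r ∩ (D ∩ g ⁻¹' Ioc s t)) :=
    Metric.isOpen_ball.measurableSet.inter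
      (measurableSet_inter_preimage_Ioc hDc hgc s t)
  have key : ∀ p ∈ Metric.ball p₀ r ∩ (D ∩ g ⁻¹' Ioc s t), ∀ τ : ℝ, 0 ≤ τ →
      p + τ • e ∈ Metric.ball p₀ r ∩ (D ∩ g ⁻¹' Ioc s t) → τ ≤ 2 * (t - s) / δ := by
    rintro p ⟨hpb, hpD, hpg⟩ τ hτ ⟨hqb, hqD, hqg⟩
    obtain ⟨z, hz, hzeq⟩ := domain_mvt (f := g) hg hD hpD hqD
    have hzδ : δ / 2 < g' z e :=
      hball ⟨(convex_ball p₀ r).segment_subset hpb hqb hz, hD.segment_subset hpD hqD hz⟩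
    rw [add_sub_cancel_left, map_smul, smul_eq_mul] at hzeq
    have h1 : g (p + τ • e) - g p ≤ t - s := by linarith [hpg.1, hqg.2]
    rw [le_div_iff₀ he]
    nlinarith
  have hle := measure_le_of_chord_le ν hmeas (e := e) (ℓ := 2 * (t - s) / δ)
    inter_subset_left (by have := sub_pos.2 hst; positivity) (by
      intro p hp τ hq
      rcases le_total 0 τ with h | h
      · rw [abs_of_nonneg h]; exact key p hp τ h hq
      · rw [abs_of_nonpos h]
        exact key _ hq (-τ) (by linarith) (by simpa [add_assoc, ← add_smul] using hp))
  refine hle.trans_eq ?_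
  have hfin : ν (Metric.ball p₀ (r + ‖e‖)) ≠ ⊤ := Metric.isBounded_ball.measure_lt_top.ne
  rw [ENNReal.coe_mul, ENNReal.coe_toNNReal hfin, mul_right_comm]
  congr 1
  rw [show ((8 / δ).toNNReal : ENNReal) = ENNReal.ofReal (8 / δ) from rfl,
    ← ENNReal.ofReal_mul (by positivity)]
  congr 1
  ring

/-- On a compact convex set, the slabs `{s < g ≤ t}` of a `C¹` function without critical points
have volume `O(t - s)`. -/
theorem exists_measure_slab_le {D : Set E} (hD : Convex ℝ D) (hDc : IsCompact D)
    {g : E → ℝ} {g' : E → E →L[ℝ] ℝ} (hg : ∀ p ∈ D, HasFDerivWithinAt g (g' p) D p)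
    (hg' : ContinuousOn g' D) (h0 : ∀ p ∈ D, g' p ≠ 0) :
    ∃ C : ℝ≥0, ∀ s t : ℝ, s < t → ν (D ∩ g ⁻¹' Ioc s t) ≤ C * ENNReal.ofReal (t - s) := by
  have := hDc.induction_on (p := fun U => ∃ C : ℝ≥0, ∀ s t : ℝ, s < t →
      ν (U ∩ (D ∩ g ⁻¹' Ioc s t)) ≤ C * ENNReal.ofReal (t - s))
    ⟨0, by simp⟩
    (fun U V hUV ⟨C, hC⟩ => ⟨C, fun s t hst =>
      (measure_mono (inter_subset_inter_left _ hUV)).trans (hC s t hst)⟩)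
    (fun U V ⟨C, hC⟩ ⟨C', hC'⟩ => ⟨C + C', fun s t hst => by
      rw [union_inter_distrib_right, ENNReal.coe_add, add_mul]
      exact (measure_union_le _ _).trans (add_le_add (hC s t hst) (hC' s t hst))⟩)
    (fun p hp => exists_nhdsWithin_measure_slab_le ν hD hDc.isClosed hg hg' hp (h0 p hp))
  simpa only [← inter_assoc, inter_self] using this

/-- A map which is `C¹` on a compact set increases volumes at most by a constant factor. -/
theorem exists_measure_image_le {D : Set E} (hDc : IsCompact D)
    {f : E → E} {f' : E → E →L[ℝ] E} (hf : ∀ p ∈ D, HasFDerivWithinAt f (f' p) D p)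
    (hf' : ContinuousOn f' D) :
    ∃ C : ℝ≥0, ∀ A ⊆ D, MeasurableSet A → ν (f '' A) ≤ C * ν A := by
  have hdet : ContinuousOn (fun p => |(f' p).det|) D :=
    (ContinuousLinearMap.continuous_det.comp_continuousOn hf').abs
  obtain ⟨C, hC⟩ := hDc.bddAbove_image hdet
  refine ⟨C.toNNReal, fun A hAD hA => ?_⟩
  calc ν (f '' A) ≤ ∫⁻ p in A, ENNReal.ofReal |(f' p).det| ∂ν :=
        addHaar_image_le_lintegral_abs_det_fderiv ν hA fun p hp => (hf p (hAD hp)).mono hAD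
    _ ≤ ∫⁻ _ in A, C.toNNReal ∂ν := setLIntegral_mono' hA fun p hp =>
        ENNReal.ofReal_le_ofReal (hC (mem_image_of_mem _ (hAD hp)))
    _ = C.toNNReal * ν A := by simp

end LevelSlabs

/-! ### Gradient ascent for concave functions with Lipschitz supergradient. -/

section ConcaveAscent

variable {E : Type*} [NormedAddCommGroup E] [InnerProductSpace ℝ E]

/-- A function with a Lipschitz supergradient is differentiable. -/
theorem hasGradientAt_of_supergradient [CompleteSpace E] {F : E → ℝ} {g : E → E} {C : ℝ≥0}
    (hg : LipschitzWith C g) (hF : ∀ x z, F z ≤ F x + inner ℝ (g x) (z - x)) (x : E) :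
    HasGradientAt F (g x) x := by
  rw [hasGradientAt_iff_isLittleO]
  have hO : (fun z => F z - F x - inner ℝ (g x) (z - x)) =O[nhds x]
      fun z => ‖z - x‖ ^ 2 := by
    refine Asymptotics.IsBigO.of_bound C (Filter.Eventually.of_forall fun z => ?_)
    rw [Real.norm_eq_abs, abs_le, Real.norm_of_nonneg (by positivity)]
    -- The supergradient inequalities at x and at z squeeze the first-order remainder between -C‖z -
    -- x‖² and 0.
    have h1 := hF x z
    have h2 := hF z x
    have h3 : |inner ℝ (g z - g x) (z - x)| ≤ C * ‖z - x‖ ^ 2 := by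
      refine (abs_real_inner_le_norm _ _).trans ?_
      rw [pow_two, ← mul_assoc]
      gcongr
      exact hg.norm_sub_le z x
    have h4 : inner ℝ (g z) (x - z) = - inner ℝ (g z) (z - x) := by
      rw [← inner_neg_right, neg_sub]
    rw [inner_sub_left] at h3
    have h5 := abs_le.1 h3
    have h6 : 0 ≤ (C : ℝ) * ‖z - x‖ ^ 2 := by positivity
    constructor <;> linarith [h5.1, h5.2]
  refine hO.trans_isLittleO ?_
  refine Asymptotics.isLittleO_norm_pow_id one_lt_two |>.comp_tendsto ?_
  exact tendsto_sub_nhds_zero_iff.2 Filter.tendsto_id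

/-- The descent lemma, for a concave function with supergradient `g`. -/
theorem le_of_lipschitz_supergradient [CompleteSpace E] {F : E → ℝ} {g : E → E} {C : ℝ≥0}
    (hg : LipschitzWith C g) (hF : ∀ x z, F z ≤ F x + inner ℝ (g x) (z - x)) (x v : E) :
    F x + inner ℝ (g x) v - C / 2 * ‖v‖ ^ 2 ≤ F (x + v) := by
  -- The claim compares the values of this function at 0 and 1; its derivative is nonnegative on (0,
  -- 1) by the Lipschitz bound.
  have hd : ∀ t : ℝ, HasDerivAt
      (fun t : ℝ => F (x + t • v) - t * inner ℝ (g x) v + C / 2 * t ^ 2 * ‖v‖ ^ 2)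
      (inner ℝ (g (x + t • v)) v - inner ℝ (g x) v + C * t * ‖v‖ ^ 2) t := by
    intro t
    have h1 : HasDerivAt (fun t : ℝ => x + t • v) v t := by
      simpa using ((hasDerivAt_id t).smul_const v).const_add x
    have h2 := (hasGradientAt_of_supergradient hg hF (x + t • v)).hasFDerivAt.comp_hasDerivAt t h1
    have h3 := (h2.sub ((hasDerivAt_id t).mul_const (inner ℝ (g x) v))).add
      ((((hasDerivAt_id t).pow 2).const_mul ((C : ℝ) / 2)).mul_const (‖v‖ ^ 2))
    refine h3.congr_deriv ?_
    simp only [InnerProductSpace.toDual_apply_apply, Nat.cast_ofNat, id]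
    ring
  have hmono := monotoneOn_of_deriv_nonneg (convex_Icc (0 : ℝ) 1)
    (fun t _ => (hd t).continuousAt.continuousWithinAt)
    (fun t _ => (hd t).differentiableAt.differentiableWithinAt) (by
      intro t ht
      rw [interior_Icc] at ht
      rw [(hd t).deriv, ← inner_sub_left]
      have h3 : |inner ℝ (g (x + t • v) - g x) v| ≤ C * t * ‖v‖ ^ 2 := by
        refine (abs_real_inner_le_norm _ _).trans ?_
        have := hg.norm_sub_le (x + t • v) x
        rw [add_sub_cancel_left, norm_smul, Real.norm_of_nonneg ht.1.le] at this
        nlinarith [norm_nonneg v]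
      linarith [(abs_le.1 h3).1])
  have := hmono (left_mem_Icc.2 zero_le_one) (right_mem_Icc.2 zero_le_one) zero_le_one
  simp at this
  linarith

/-- Cocoercivity of a Lipschitz supergradient (Baillon–Haddad). -/
theorem norm_sq_sub_le_of_supergradient [CompleteSpace E] {F : E → ℝ} {g : E → E} {C : ℝ≥0}
    (hg : LipschitzWith C g) (hF : ∀ x z, F z ≤ F x + inner ℝ (g x) (z - x)) (x z : E) :
    ‖g x - g z‖ ^ 2 ≤ - (C * inner ℝ (g x - g z) (x - z)) := by
  rcases eq_or_lt_of_le (zero_le : (0 : ℝ≥0) ≤ C) with hC | hC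
  · have := hg.norm_sub_le x z
    rw [← hC, NNReal.coe_zero, zero_mul] at this
    rw [← hC, NNReal.coe_zero, zero_mul, neg_zero]
    have h0 : ‖g x - g z‖ = 0 := le_antisymm this (norm_nonneg _)
    simp [h0]
  have hC' : (0 : ℝ) < C := hC
  -- At z + v, compare the descent lower bound from z with the supergradient upper bound from x; v =
  -- (g z - g x)/C is the optimal choice. Adding `key` for (x, z) and (z, x) eliminates F.
  have key : ∀ x z : E, ‖g x - g z‖ ^ 2 ≤ 2 * C * (F x + inner ℝ (g x) (z - x) - F z) := by
    intro x z
    have h1 := le_of_lipschitz_supergradient hg hF z ((1 / (C : ℝ)) • (g z - g x))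
    have h2 := hF x (z + (1 / (C : ℝ)) • (g z - g x))
    have h3 := h1.trans h2
    have e1 : ‖(1 / (C : ℝ)) • (g z - g x)‖ ^ 2 = (1 / C) ^ 2 * ‖g x - g z‖ ^ 2 := by
      rw [norm_smul, mul_pow, norm_sub_rev, Real.norm_of_nonneg (by positivity)]
    have e2 : z + (1 / (C : ℝ)) • (g z - g x) - x = (z - x) + (1 / (C : ℝ)) • (g z - g x) := by
      abel
    have e3 : inner ℝ (g z) (g z - g x) - inner ℝ (g x) (g z - g x) = ‖g x - g z‖ ^ 2 := by
      rw [← inner_sub_left, real_inner_self_eq_norm_sq, norm_sub_rev]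
    rw [e1, e2, inner_add_right, inner_smul_right, inner_smul_right] at h3
    have e4 : C / 2 * ((1 / (C : ℝ)) ^ 2 * ‖g x - g z‖ ^ 2) = 1 / C * (‖g x - g z‖ ^ 2 / 2) := by
      field_simp
    rw [e4, ← e3] at h3
    have h5 : 1 / (C : ℝ) * (‖g x - g z‖ ^ 2 / 2) ≤ F x + inner ℝ (g x) (z - x) - F z := by
      rw [← e3]; linarith
    calc ‖g x - g z‖ ^ 2 = 2 * C * (1 / (C : ℝ) * (‖g x - g z‖ ^ 2 / 2)) := by field_simp
      _ ≤ _ := by gcongr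
  have h1 := key x z
  have h2 := key z x
  rw [norm_sub_rev] at h2
  have e : inner ℝ (g x) (z - x) = - inner ℝ (g x) (x - z) := by
    rw [← inner_neg_right, neg_sub]
  rw [inner_sub_left]
  nlinarith

/-- One step of gradient ascent on `F - γ/2 ‖·‖²`, with the optimal step size, is a contraction. -/
theorem norm_ascent_step_sub_le [CompleteSpace E] {F : E → ℝ} {g : E → E} {C : ℝ≥0}
    (hg : LipschitzWith C g) (hF : ∀ x z, F z ≤ F x + inner ℝ (g x) (z - x))
    {γ : ℝ} (hγ : 0 < γ) (x z : E) :
    ‖(x + (2 / (C + 2 * γ)) • (g x - γ • x)) - (z + (2 / (C + 2 * γ)) • (g z - γ • z))‖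
      ≤ C / (C + 2 * γ) * ‖x - z‖ := by
  have hC := C.coe_nonneg
  have hpos : (0 : ℝ) < C + 2 * γ := by positivity
  set a : ℝ := C / (C + 2 * γ) with ha
  set h : ℝ := 2 / (C + 2 * γ) with hh
  have h0 : 0 ≤ h := by positivity
  -- These two identities explain the step size: with 2a = hC, the cross term of ‖a(x - z) + h(g x -
  -- g z)‖² exactly absorbs the cocoercivity bound on the last square.
  have ea : a = 1 - h * γ := by rw [ha, hh]; field_simp; ring
  have eah : 2 * a = h * C := by rw [ha, hh]; ring
  have e : (x + h • (g x - γ • x)) - (z + h • (g z - γ • z))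
      = a • (x - z) + h • (g x - g z) := by rw [ea]; module
  rw [e]
  refine le_of_sq_le_sq ?_ (by positivity)
  rw [norm_add_sq_real, norm_smul, norm_smul, inner_smul_left, inner_smul_right, mul_pow, mul_pow,
    mul_pow, Real.norm_eq_abs, Real.norm_eq_abs, sq_abs, sq_abs, real_inner_comm]
  have hco := norm_sq_sub_le_of_supergradient hg hF x z
  have : h ^ 2 * ‖g x - g z‖ ^ 2 ≤ h ^ 2 * - (C * inner ℝ (g x - g z) (x - z)) := by gcongr
  have e5 : 2 * (a * (h * inner ℝ (g x - g z) (x - z)))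
     = h ^ 2 * (C * inner ℝ (g x - g z) (x - z)) := by
    linear_combination h * inner ℝ (g x - g z) (x - z) * eah
  simp only [conj_trivial]
  linarith

/-- The regularized problem has a critical point. -/
theorem exists_eq_smul_of_supergradient [CompleteSpace E] {F : E → ℝ} {g : E → E} {C : ℝ≥0}
    (hg : LipschitzWith C g) (hF : ∀ x z, F z ≤ F x + inner ℝ (g x) (z - x))
    {γ : ℝ} (hγ : 0 < γ) : ∃ x, g x = γ • x := by
  have hpos : (0 : ℝ) < C + 2 * γ := by have := C.coe_nonneg; positivity
  -- Existence comes from Banach's fixed point theorem applied to the ascent step itself.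
  let T : E → E := fun x => x + (2 / (C + 2 * γ)) • (g x - γ • x)
  have hT : ContractingWith (C / (C + 2 * γ)).toNNReal T := by
    refine ⟨?_, LipschitzWith.of_dist_le_mul fun x z => ?_⟩
    · rw [Real.toNNReal_lt_one, div_lt_one hpos]
      linarith
    · rw [dist_eq_norm, dist_eq_norm, Real.coe_toNNReal _ (by positivity)]
      exact norm_ascent_step_sub_le hg hF hγ x z
  have hfix : T hT.fixedPoint = hT.fixedPoint := hT.fixedPoint_isFixedPt
  refine ⟨hT.fixedPoint, ?_⟩
  have h2 : (2 / (C + 2 * γ)) • (g hT.fixedPoint - γ • hT.fixedPoint) = 0 :=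
    add_eq_left.1 hfix
  rcases smul_eq_zero.1 h2 with h | h
  · exact absurd h (by positivity)
  · exact sub_eq_zero.1 h

/-- Quadratic growth at the critical point of the regularized problem. -/
theorem regularized_le_of_supergradient {F : E → ℝ} {g : E → E}
    (hF : ∀ x z, F z ≤ F x + inner ℝ (g x) (z - x)) {γ : ℝ} {x : E} (hx : g x = γ • x) (z : E) :
    F z - γ / 2 * ‖z‖ ^ 2 ≤ F x - γ / 2 * ‖x‖ ^ 2 - γ / 2 * ‖z - x‖ ^ 2 := by
  have h1 := hF x z
  rw [hx, inner_smul_left, inner_sub_right, real_inner_self_eq_norm_sq] at h1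
  rw [norm_sub_sq_real, real_inner_comm]
  simp only [conj_trivial] at h1
  linarith

end ConcaveAscent

/-! ### Mass of slabs of cost differences, through the charts. -/

variable {n N : ℕ}

section SlabMass

variable {X : Set (EuclideanSpace ℝ (Fin n))}
  {c : EuclideanSpace ℝ (Fin n) → EuclideanSpace ℝ (Fin n) → ℝ}
  {y : Fin N → EuclideanSpace ℝ (Fin n)} {i k : Fin N}

namespace LoeperChart

theorem image_inv (L : LoeperChart X c y i) : L.inv '' X = L.dom :=
  L.mapsTo_inv.image_subset.antisymm fun p hp => ⟨L.exp p, L.mapsTo_exp hp, L.invOn.1 hp⟩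

theorem image_exp (L : LoeperChart X c y i) : L.exp '' L.dom = X :=
  L.mapsTo_exp.image_subset.antisymm fun x hx => ⟨L.inv x, L.mapsTo_inv hx, L.invOn.2 hx⟩

theorem isCompact_dom (L : LoeperChart X c y i) (hX : IsCompact X) : IsCompact L.dom :=
  L.image_inv ▸ hX.image_of_continuousOn L.contDiffOn_inv.continuousOn

/-- A convex set without interior is null, and its image X under the C² map `exp` would be null too.
-/
theorem uniqueDiffOn_dom (L : LoeperChart X c y i) (hvol : volume X ≠ 0) :
    UniqueDiffOn ℝ L.dom := by
  refine uniqueDiffOn_convex L.convex_dom (nonempty_iff_ne_empty.2 fun h => hvol ?_)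
  rw [← L.image_exp]
  refine addHaar_image_eq_zero_of_differentiableOn_of_addHaar_eq_zero volume
    (L.contDiffOn_exp.differentiableOn two_ne_zero) ?_
  refine measure_mono_null ?_ (L.convex_dom.addHaar_frontier volume)
  rw [frontier, h, sdiff_empty]
  exact subset_closure

/-- The chain rule for `inv ∘ exp = id` gives a left inverse of the derivative; in finite dimension
injective means surjective. -/
theorem surjective_fderivWithin_exp (L : LoeperChart X c y i) (hvol : volume X ≠ 0)
    {p : EuclideanSpace ℝ (Fin n)} (hp : p ∈ L.dom) :
    Function.Surjective (fderivWithin ℝ L.exp L.dom p) := by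
  have h1 := (L.contDiffOn_exp.differentiableOn two_ne_zero p hp).hasFDerivWithinAt
  have h2 := (L.contDiffOn_inv.differentiableOn two_ne_zero _ (L.mapsTo_exp hp)).hasFDerivWithinAt
  have h3 : HasFDerivWithinAt (L.inv ∘ L.exp) (ContinuousLinearMap.id ℝ _) L.dom p :=
    (hasFDerivWithinAt_id p L.dom).congr L.invOn.1 (L.invOn.1 hp)
  have h4 := (L.uniqueDiffOn_dom hvol p hp).eq (h2.comp p h1 L.mapsTo_exp) h3
  have hinj : Function.Injective (fderivWithin ℝ L.exp L.dom p) := by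
    refine Function.LeftInverse.injective (g := fderivWithin ℝ L.inv X (L.exp p)) fun v => ?_
    exact congrArg (fun A : EuclideanSpace ℝ (Fin n) →L[ℝ] EuclideanSpace ℝ (Fin n) => A v) h4
  exact (LinearMap.injective_iff_surjective
    (f := (fderivWithin ℝ L.exp L.dom p : EuclideanSpace ℝ (Fin n) →ₗ[ℝ] _))).1 hinj

theorem exists_volume_slab_le (L : LoeperChart X c y i) (hX : IsCompact X) (hvol : volume X ≠ 0)
    (hreg : CostRegular X c y) (htwist : CostTwist X c y) (hik : i ≠ k) :
    ∃ C : ℝ≥0, ∀ s t : ℝ, s < t →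
      volume (X ∩ (fun x => c x (y i) - c x (y k)) ⁻¹' Ioc s t) ≤ C * ENNReal.ofReal (t - s) := by
  set f : EuclideanSpace ℝ (Fin n) → ℝ := fun x => c x (y i) - c x (y k)
  have hfC : ContDiffOn ℝ 2 f X := (hreg i).sub (hreg k)
  have hgC : ContDiffOn ℝ 2 (f ∘ L.exp) L.dom := hfC.comp L.contDiffOn_exp L.mapsTo_exp
  have hU := L.uniqueDiffOn_dom hvol
  have hD := L.isCompact_dom hX
  obtain ⟨C₁, hC₁⟩ := exists_measure_slab_le volume L.convex_dom hD
    (fun p hp => (hgC.differentiableOn two_ne_zero p hp).hasFDerivWithinAt)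
    (hgC.continuousOn_fderivWithin hU one_le_two) (by
      -- A critical point of f ∘ exp would be one of f, since the derivative of `exp` is onto; twist
      -- forbids this.
      intro p hp h0
      have hx := L.mapsTo_exp hp
      have h1 := (L.contDiffOn_exp.differentiableOn two_ne_zero p hp).hasFDerivWithinAt
      have h2 := ((hreg i).differentiableOn two_ne_zero _ hx).hasFDerivWithinAt.sub
        ((hreg k).differentiableOn two_ne_zero _ hx).hasFDerivWithinAt
      have h3 := (hgC.differentiableOn two_ne_zero p hp).hasFDerivWithinAt
      rw [h0] at h3
      have h4 := (hU p hp).eq (h2.comp p h1 L.mapsTo_exp) h3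
      refine htwist _ hx i k hik ?_
      unfold gradientWithin
      congr 1
      rw [← sub_eq_zero]
      ext v
      obtain ⟨u, rfl⟩ := L.surjective_fderivWithin_exp hvol hp v
      exact congrArg (fun A : EuclideanSpace ℝ (Fin n) →L[ℝ] ℝ => A u) h4)
  obtain ⟨C₂, hC₂⟩ := exists_measure_image_le volume hD
    (fun p hp => (L.contDiffOn_exp.differentiableOn two_ne_zero p hp).hasFDerivWithinAt)
    (L.contDiffOn_exp.continuousOn_fderivWithin hU one_le_two)
  refine ⟨C₂ * C₁, fun s t hst => ?_⟩
  have himg : X ∩ f ⁻¹' Ioc s t = L.exp '' (L.dom ∩ (f ∘ L.exp) ⁻¹' Ioc s t) := by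
    rw [preimage_comp, image_inter_preimage, L.image_exp]
  rw [himg, ENNReal.coe_mul, mul_assoc]
  refine (hC₂ _ inter_subset_left
    (measurableSet_inter_preimage_Ioc hD.isClosed hgC.continuousOn s t)).trans ?_
  gcongr
  exact hC₁ s t hst

end LoeperChart

/-- Slabs of the cost differences have mass `O(t - s)`. -/
def SlabBound (X : Set (EuclideanSpace ℝ (Fin n)))
    (c : EuclideanSpace ℝ (Fin n) → EuclideanSpace ℝ (Fin n) → ℝ)
    (y : Fin N → EuclideanSpace ℝ (Fin n)) (μ : Measure (EuclideanSpace ℝ (Fin n))) (C : ℝ) :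
    Prop :=
  ∀ i k, i ≠ k → ∀ s t : ℝ, s < t →
    μ.real (X ∩ (fun x => c x (y i) - c x (y k)) ⁻¹' Ioc s t) ≤ C * (t - s)

/-- The density is bounded on the compact X, so volume bounds become mass bounds. Summing the
constants over all pairs gives a uniform one. -/
theorem exists_slabBound (hX : IsCompact X)
    (hreg : CostRegular X c y) (htwist : CostTwist X c y) (L : ∀ i, LoeperChart X c y i)
    (μ : Measure (EuclideanSpace ℝ (Fin n))) [IsProbabilityMeasure μ]
    (ρ : EuclideanSpace ℝ (Fin n) → ℝ)
    (hμ : μ = (volume.restrict X).withDensity fun x => ENNReal.ofReal (ρ x))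
    (hρ : ContinuousOn ρ X) : ∃ C : ℝ, 0 ≤ C ∧ SlabBound X c y μ C := by
  have hvol : volume X ≠ 0 := by
    intro h
    have h1 : μ univ = 1 := measure_univ
    rw [hμ, Measure.restrict_eq_zero.2 h] at h1
    simp at h1
  obtain ⟨M, hM⟩ := hX.bddAbove_image hρ
  have hle : ∀ A ⊆ X, MeasurableSet A → μ A ≤ M.toNNReal * volume A := by
    intro A hAX hA
    rw [hμ, withDensity_apply _ hA, Measure.restrict_restrict hA, inter_eq_left.2 hAX]
    calc ∫⁻ x in A, ENNReal.ofReal (ρ x) ≤ ∫⁻ _ in A, M.toNNReal :=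
          setLIntegral_mono' hA fun x hx =>
            ENNReal.ofReal_le_ofReal (hM (mem_image_of_mem _ (hAX hx)))
      _ = M.toNNReal * volume A := by simp
  have hC : ∀ i k, ∃ C : ℝ≥0, i ≠ k → ∀ s t : ℝ, s < t →
      volume (X ∩ (fun x => c x (y i) - c x (y k)) ⁻¹' Ioc s t) ≤ C * ENNReal.ofReal (t - s) := by
    intro i k
    by_cases hik : i = k
    · exact ⟨0, fun h => absurd hik h⟩
    · obtain ⟨C, hC⟩ := (L i).exists_volume_slab_le hX hvol hreg htwist hik
      exact ⟨C, fun _ => hC⟩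
  choose C hC using hC
  refine ⟨M.toNNReal * ∑ i, ∑ k, C i k, by positivity, fun i k hik s t hst => ?_⟩
  have hfc : ContinuousOn (fun x => c x (y i) - c x (y k)) X :=
    (hreg i).continuousOn.sub (hreg k).continuousOn
  have h1 := (hle _ inter_subset_left
    (measurableSet_inter_preimage_Ioc hX.isClosed hfc s t)).trans
    (mul_le_mul_right (hC i k hik s t hst) _)
  have h2 : C i k ≤ ∑ i, ∑ k, C i k :=
    (Finset.single_le_sum (f := fun k => C i k) (fun _ _ => zero_le) (Finset.mem_univ k)).trans
      (Finset.single_le_sum (f := fun i => ∑ k, C i k) (fun _ _ => zero_le) (Finset.mem_univ i))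
  have h3 := ENNReal.toReal_mono (by finiteness) h1
  rw [ENNReal.toReal_mul, ENNReal.toReal_mul, ENNReal.coe_toReal, ENNReal.coe_toReal,
    ENNReal.toReal_ofReal (sub_nonneg.2 hst.le)] at h3
  refine h3.trans ?_
  rw [← mul_assoc]
  have h4 : (C i k : ℝ) ≤ ∑ i, ∑ k, (C i k : ℝ) := by exact_mod_cast h2
  have := sub_nonneg.2 hst.le
  gcongr

end SlabMass

/-! ### Laguerre cells: Lipschitz masses and negligible ties. -/

section Cells

variable {X : Set (EuclideanSpace ℝ (Fin n))}
  {c : EuclideanSpace ℝ (Fin n) → EuclideanSpace ℝ (Fin n) → ℝ}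
  {y : Fin N → EuclideanSpace ℝ (Fin n)} {μ : Measure (EuclideanSpace ℝ (Fin n))}

theorem mem_laguerreCell {ψ : EuclideanSpace ℝ (Fin N)} {i : Fin N}
    {x : EuclideanSpace ℝ (Fin n)} : x ∈ laguerreCell X c y ψ i ↔
      x ∈ X ∧ ∀ j, c x (y i) + ψ i ≤ c x (y j) + ψ j := by
  have : Nonempty (Fin N) := ⟨i⟩
  refine and_congr_right fun _ => ⟨fun h j => h ▸ ciInf_le (finite_range _).bddBelow j, fun h => ?_⟩
  exact le_antisymm (le_ciInf h) (ciInf_le (finite_range _).bddBelow i)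

theorem measurableSet_laguerreCell (hX : IsCompact X)
    (hc : ∀ i, ContinuousOn (fun x => c x (y i)) X) (ψ : EuclideanSpace ℝ (Fin N)) (i : Fin N) :
    MeasurableSet (laguerreCell X c y ψ i) := by
  have h : laguerreCell X c y ψ i
      = ⋂ j, X ∩ (fun x => c x (y i) - c x (y j)) ⁻¹' Iic (ψ j - ψ i) := by
    ext x
    have : Nonempty (Fin N) := ⟨i⟩
    rw [mem_laguerreCell, ← inter_iInter]
    simp only [mem_inter_iff, mem_iInter, mem_preimage, mem_Iic]
    refine and_congr_right fun _ => forall_congr' fun j => ?_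
    constructor <;> intro h <;> linarith
  rw [h]
  exact MeasurableSet.iInter fun j =>
    (((hc i).sub (hc j)).preimage_isClosed_of_isClosed hX.isClosed isClosed_Iic).measurableSet

theorem abs_cellMass_sub_le (hX : IsCompact X) (hc : ∀ i, ContinuousOn (fun x => c x (y i)) X)
    [IsFiniteMeasure μ] {C : ℝ} (hC0 : 0 ≤ C) (hC : SlabBound X c y μ C)
    (ψ φ : EuclideanSpace ℝ (Fin N)) (i : Fin N) :
    |cellMass X c y μ ψ i - cellMass X c y μ φ i| ≤ N * (2 * C) * ‖ψ - φ‖ := by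
  let a : Fin N → ℝ := fun j => ψ j - ψ i
  let b : Fin N → ℝ := fun j => φ j - φ i
  -- Half-open slabs fit: one cell gives a weak inequality, leaving the other a strict one.
  let S : Fin N → Set (EuclideanSpace ℝ (Fin n)) := fun j =>
    X ∩ (fun x => c x (y i) - c x (y j)) ⁻¹' Ioc (min (a j) (b j)) (max (a j) (b j))
  have hsub : symmDiff (laguerreCell X c y ψ i) (laguerreCell X c y φ i) ⊆ ⋃ j, S j := by
    intro x hx
    simp only [mem_symmDiff, mem_laguerreCell, not_and, not_forall, not_le] at hx
    rw [mem_iUnion]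
    rcases hx with ⟨⟨hxX, h1⟩, h2⟩ | ⟨⟨hxX, h1⟩, h2⟩
    all_goals
      obtain ⟨j, hj⟩ := h2 hxX
      have := h1 j
      refine ⟨j, hxX, ?_, ?_⟩
    · exact min_lt_of_right_lt (by simp only [b]; linarith)
    · exact le_max_of_le_left (by simp only [a]; linarith)
    · exact min_lt_of_left_lt (by simp only [a]; linarith)
    · exact le_max_of_le_right (by simp only [b]; linarith)
  have hcoord : ∀ j, |ψ j - φ j| ≤ ‖ψ - φ‖ := fun j => PiLp.norm_apply_le (ψ - φ) j
  have hS : ∀ j, μ.real (S j) ≤ 2 * C * ‖ψ - φ‖ := by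
    intro j
    have hab : |a j - b j| ≤ 2 * ‖ψ - φ‖ := by
      have e : a j - b j = (ψ j - φ j) - (ψ i - φ i) := by simp only [a, b]; ring
      rw [e]
      linarith [abs_sub (ψ j - φ j) (ψ i - φ i), hcoord j, hcoord i]
    rcases eq_or_ne (a j) (b j) with h | h
    · have : S j = ∅ := by simp [S, h]
      rw [this, measureReal_empty]
      positivity
    · have hij : i ≠ j := by
        rintro rfl
        simp [a, b] at h
      refine (hC i j hij _ _ (min_lt_max.2 h)).trans ?_
      rw [max_sub_min_eq_abs', mul_assoc, mul_left_comm]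
      gcongr
  calc |cellMass X c y μ ψ i - cellMass X c y μ φ i|
      ≤ μ.real (symmDiff (laguerreCell X c y ψ i) (laguerreCell X c y φ i)) :=
        abs_measureReal_sub_le_measureReal_symmDiff
          (measurableSet_laguerreCell hX hc ψ i).nullMeasurableSet
          (measurableSet_laguerreCell hX hc φ i).nullMeasurableSet
    _ ≤ μ.real (⋃ j, S j) := measureReal_mono hsub
    _ ≤ ∑ j, μ.real (S j) := measureReal_iUnion_fintype_le _
    _ ≤ ∑ _j : Fin N, 2 * C * ‖ψ - φ‖ := Finset.sum_le_sum fun j _ => hS j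
    _ = N * (2 * C) * ‖ψ - φ‖ := by simp; ring

theorem exists_lipschitzWith_cellMass (hX : IsCompact X)
    (hc : ∀ i, ContinuousOn (fun x => c x (y i)) X)
    [IsFiniteMeasure μ] {C : ℝ} (hC0 : 0 ≤ C) (hC : SlabBound X c y μ C) :
    ∃ K : ℝ≥0, LipschitzWith K (cellMass X c y μ) := by
  refine ⟨_, (PiLp.lipschitzWith_toLp 2 _).comp
    (LipschitzWith.of_dist_le_mul (K := (N * (2 * C)).toNNReal) fun ψ φ => ?_)⟩
  rw [Real.coe_toNNReal _ (by positivity), dist_pi_le_iff (by positivity)]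
  intro i
  rw [Real.dist_eq, dist_eq_norm ψ φ]
  exact abs_cellMass_sub_le hX hc hC0 hC ψ φ i

theorem measure_tie_eq_zero [IsFiniteMeasure μ] {C : ℝ} (hC : SlabBound X c y μ C)
    {i k : Fin N} (hik : i ≠ k) (a : ℝ) :
    μ {x | x ∈ X ∧ c x (y i) - c x (y k) = a} = 0 := by
  rw [← measureReal_eq_zero_iff]
  refine le_antisymm (le_of_forall_pos_le_add fun ε hε => ?_) measureReal_nonneg
  -- A slab of this width has mass at most ε, whatever the sign of C.
  have h1 := hC i k hik (a - ε / (|C| + 1)) a (by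
    have : 0 < ε / (|C| + 1) := by positivity
    linarith)
  have h2 : μ.real {x | x ∈ X ∧ c x (y i) - c x (y k) = a} ≤
      μ.real (X ∩ (fun x => c x (y i) - c x (y k)) ⁻¹' Ioc (a - ε / (|C| + 1)) a) := by
    refine measureReal_mono fun x hx => ⟨hx.1, ?_⟩
    have : 0 < ε / (|C| + 1) := by positivity
    simp only [mem_preimage, mem_Ioc, hx.2]
    constructor <;> linarith
  refine (h2.trans h1).trans ?_
  rw [zero_add, sub_sub_cancel, ← mul_div_assoc, div_le_iff₀ (by positivity)]
  nlinarith [le_abs_self C, abs_nonneg C]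

/-- Almost every point lies in exactly one Laguerre cell. -/
theorem ae_existsUnique_mem_laguerreCell (hN : 0 < N) [IsFiniteMeasure μ] {C : ℝ}
    (hC : SlabBound X c y μ C) (hμX : ∀ᵐ x ∂μ, x ∈ X) (ψ : EuclideanSpace ℝ (Fin N)) :
    ∀ᵐ x ∂μ, ∃! i, x ∈ laguerreCell X c y ψ i := by
  have : Nonempty (Fin N) := ⟨⟨0, hN⟩⟩
  have htie : ∀ᵐ x ∂μ, ∀ i k, i ≠ k → ¬ (x ∈ X ∧ c x (y i) - c x (y k) = ψ k - ψ i) := by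
    simp only [ae_all_iff]
    intro i k hik
    simpa [ae_iff] using measure_tie_eq_zero hC hik (ψ k - ψ i)
  filter_upwards [hμX, htie] with x hx hxt
  obtain ⟨i, hi⟩ := Finite.exists_min fun i => c x (y i) + ψ i
  refine ⟨i, mem_laguerreCell.2 ⟨hx, hi⟩, fun k hk => ?_⟩
  by_contra hne
  have := (mem_laguerreCell.1 hk).2 i
  exact hxt k i hne ⟨hx, by linarith [hi k]⟩

end Cells

/-! ### Kantorovich's functional and the a priori bound. -/

section Kantorovich

variable {X : Set (EuclideanSpace ℝ (Fin n))}
  {c : EuclideanSpace ℝ (Fin n) → EuclideanSpace ℝ (Fin n) → ℝ}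
  {y : Fin N → EuclideanSpace ℝ (Fin n)} {μ : Measure (EuclideanSpace ℝ (Fin n))}

theorem integrableOn_iInf_cost (hN : 0 < N) (hX : IsCompact X)
    (hc : ∀ i, ContinuousOn (fun x => c x (y i)) X) [IsFiniteMeasure μ]
    (ψ : EuclideanSpace ℝ (Fin N)) :
    IntegrableOn (fun x => ⨅ i, (c x (y i) + ψ i)) X μ := by
  have : Nonempty (Fin N) := ⟨⟨0, hN⟩⟩
  refine ContinuousOn.integrableOn_compact hX ?_
  simp only [← Finset.inf'_univ_eq_ciInf]
  exact ContinuousOn.finset_inf'_apply _ fun i _ => (hc i).add continuousOn_const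

/-- The vector of the masses of the cells, minus the weights, is a supergradient of Kantorovich's
functional. -/
theorem kantorovich_le (hN : 0 < N) (hX : IsCompact X)
    (hc : ∀ i, ContinuousOn (fun x => c x (y i)) X) [IsFiniteMeasure μ]
    {C : ℝ} (hC : SlabBound X c y μ C) (hμX : ∀ᵐ x ∂μ, x ∈ X)
    (w ψ φ : EuclideanSpace ℝ (Fin N)) :
    kantorovich X c y μ w φ ≤
      kantorovich X c y μ w ψ + inner ℝ (cellMass X c y μ ψ - w) (φ - ψ) := by
  have hmeas := fun i => measurableSet_laguerreCell hX hc ψ i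
  have hint : ∀ i, Integrable
      ((laguerreCell X c y ψ i).indicator fun _ => φ i - ψ i) (μ.restrict X) :=
    fun i => (integrable_const _).indicator (hmeas i)
  -- Almost everywhere only the indicator of the cell containing x survives, and its index is a
  -- competitor in the minimum for φ.
  have hpt : ∀ᵐ x ∂(μ.restrict X), (⨅ i, (c x (y i) + φ i)) ≤ (⨅ i, (c x (y i) + ψ i)) +
      ∑ i, (laguerreCell X c y ψ i).indicator (fun _ => φ i - ψ i) x := by
    filter_upwards [ae_restrict_of_ae (ae_existsUnique_mem_laguerreCell hN hC hμX ψ)] with x hx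
    obtain ⟨i, hi, huniq⟩ := hx
    rw [Finset.sum_eq_single i (fun k _ hk => indicator_of_notMem (fun h => hk (huniq k h)) _)
      (by simp), indicator_of_mem hi, ← hi.2]
    refine (ciInf_le (finite_range _).bddBelow i).trans ?_
    linarith
  have h1 := integral_mono_ae (integrableOn_iInf_cost hN hX hc φ)
    ((integrableOn_iInf_cost hN hX hc ψ).add (integrable_finsetSum _ fun i _ => hint i)) (by
      filter_upwards [hpt] with x hx
      simpa using hx)
  have h2 : ∫ x in X, ∑ i, (laguerreCell X c y ψ i).indicator (fun _ => φ i - ψ i) x ∂μ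
      = inner ℝ (cellMass X c y μ ψ) (φ - ψ) := by
    rw [integral_finsetSum _ fun i _ => hint i, PiLp.inner_apply]
    refine Finset.sum_congr rfl fun i _ => ?_
    rw [integral_indicator_const _ (hmeas i), measureReal_restrict_apply (hmeas i),
      inter_eq_left.2 fun x hx => hx.1]
    simp [cellMass, mul_comm]
  simp only [Pi.add_apply] at h1
  rw [integral_add (integrableOn_iInf_cost hN hX hc ψ) (integrable_finsetSum _ fun i _ => hint i),
    h2] at h1
  unfold kantorovich
  rw [inner_sub_left, inner_sub_right (𝕜 := ℝ) w, real_inner_comm w φ, real_inner_comm w ψ]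
  linarith

theorem sum_cellMass (hN : 0 < N) (hX : IsCompact X)
    (hc : ∀ i, ContinuousOn (fun x => c x (y i)) X) [IsProbabilityMeasure μ]
    {C : ℝ} (hC : SlabBound X c y μ C) (hμX : ∀ᵐ x ∂μ, x ∈ X) (ψ : EuclideanSpace ℝ (Fin N)) :
    ∑ i, cellMass X c y μ ψ i = 1 := by
  have hmeas := fun i => measurableSet_laguerreCell hX hc ψ i
  have hint : ∀ i, Integrable ((laguerreCell X c y ψ i).indicator fun _ => (1 : ℝ)) μ :=
    fun i => (integrable_const _).indicator (hmeas i)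
  calc ∑ i, cellMass X c y μ ψ i
      = ∑ i, ∫ x, (laguerreCell X c y ψ i).indicator (fun _ => (1 : ℝ)) x ∂μ := by
        simp [cellMass, integral_indicator_const _ (hmeas _)]
    _ = ∫ x, ∑ i, (laguerreCell X c y ψ i).indicator (fun _ => (1 : ℝ)) x ∂μ :=
        (integral_finsetSum _ fun i _ => hint i).symm
    _ = ∫ _, (1 : ℝ) ∂μ := by
        refine integral_congr_ae ?_
        filter_upwards [ae_existsUnique_mem_laguerreCell hN hC hμX ψ] with x hx
        obtain ⟨i, hi, huniq⟩ := hx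
        rw [Finset.sum_eq_single i (fun k _ hk => indicator_of_notMem (fun h => hk (huniq k h)) _)
          (by simp), indicator_of_mem hi]
    _ = 1 := by simp

/-- Compactness matters here: a real `⨆` over an unbounded family would be 0. -/
theorem sqrt_mul_sub_le_oscBound (hX : IsCompact X)
    (hc : ∀ i, ContinuousOn (fun x => c x (y i)) X) {x : EuclideanSpace ℝ (Fin n)} (hx : x ∈ X)
    (i j : Fin N) : √(N : ℝ) * (c x (y j) - c x (y i)) ≤ oscBound X c y := by
  have : Nonempty (Fin N) := ⟨i⟩
  choose B hB using fun i => hX.exists_bound_of_continuousOn (hc i)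
  obtain ⟨k, hk⟩ := Finite.exists_max B
  have hbdd : BddAbove (range fun x : X => (⨆ i, c x (y i)) - ⨅ i, c x (y i)) := by
    refine ⟨B k - -B k, ?_⟩
    rintro _ ⟨z, rfl⟩
    have h : ∀ i, |c z (y i)| ≤ B k := fun i => (hB i z z.2).trans (hk i)
    exact sub_le_sub (ciSup_le fun i => (abs_le.1 (h i)).2) (le_ciInf fun i => (abs_le.1 (h i)).1)
  refine mul_le_mul_of_nonneg_left (le_trans ?_ (le_ciSup hbdd ⟨x, hx⟩)) (Real.sqrt_nonneg _)
  exact sub_le_sub (le_ciSup (f := fun i => c x (y i)) (finite_range _).bddAbove j)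
    (ciInf_le (f := fun i => c x (y i)) (finite_range _).bddBelow i)

/-- A priori bound on the critical point: the cell of its largest coordinate is nonempty. -/
theorem norm_le_oscBound (hN : 0 < N) (hX : IsCompact X)
    (hc : ∀ i, ContinuousOn (fun x => c x (y i)) X) [IsProbabilityMeasure μ]
    {C : ℝ} (hC : SlabBound X c y μ C) (hμX : ∀ᵐ x ∂μ, x ∈ X) {w : EuclideanSpace ℝ (Fin N)}
    (hw0 : ∀ i, 0 < w i) (hw1 : ∑ i, w i = 1) {γ : ℝ} (hγ : 0 < γ)
    {ψ : EuclideanSpace ℝ (Fin N)} (hψ : cellMass X c y μ ψ - w = γ • ψ) :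
    ‖ψ‖ ≤ oscBound X c y := by
  have : Nonempty (Fin N) := ⟨⟨0, hN⟩⟩
  have hcoord : ∀ i, cellMass X c y μ ψ i - w i = γ * ψ i := fun i =>
    congrArg (fun v : EuclideanSpace ℝ (Fin N) => v i) hψ
  -- Masses and weights both total 1, so 0 lies between the extreme coordinates of ψ, and their gap
  -- bounds every |ψ i|.
  have hsum : ∑ i, ψ i = 0 := by
    have h : γ * ∑ i, ψ i = 0 := by
      rw [Finset.mul_sum, ← Finset.sum_congr rfl fun i _ => hcoord i, Finset.sum_sub_distrib,
        sum_cellMass hN hX hc hC hμX, hw1, sub_self]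
    exact (mul_eq_zero.1 h).resolve_left hγ.ne'
  obtain ⟨m, hm⟩ := Finite.exists_max ψ
  obtain ⟨l, hl⟩ := Finite.exists_min ψ
  have hm0 : 0 ≤ ψ m := by
    by_contra! h
    have := Finset.sum_neg (fun i _ => (hm i).trans_lt h) Finset.univ_nonempty
    linarith
  have hl0 : ψ l ≤ 0 := by
    by_contra! h
    have := Finset.sum_pos (fun i _ => h.trans_le (hl i)) Finset.univ_nonempty
    linarith
  -- An empty cell would give γ ψ m = -w m < 0. A point of the cell bounds ψ m - ψ l by a cost
  -- difference.
  obtain ⟨x, hx⟩ : (laguerreCell X c y ψ m).Nonempty := by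
    rw [nonempty_iff_ne_empty]
    intro h
    have h1 := hcoord m
    simp only [cellMass, h, measureReal_empty] at h1
    nlinarith [hw0 m]
  have hosc := sqrt_mul_sub_le_oscBound hX hc (mem_laguerreCell.1 hx).1 m l
  have hxl := (mem_laguerreCell.1 hx).2 l
  have hR : √(N : ℝ) * (ψ m - ψ l) ≤ oscBound X c y :=
    (mul_le_mul_of_nonneg_left (by linarith) (Real.sqrt_nonneg _)).trans hosc
  refine le_trans ?_ hR
  rw [EuclideanSpace.norm_eq, ← Real.sqrt_sq (show 0 ≤ ψ m - ψ l by linarith),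
    ← Real.sqrt_mul (by positivity)]
  refine Real.sqrt_le_sqrt ?_
  calc ∑ i, ‖ψ i‖ ^ 2 ≤ ∑ _i : Fin N, (ψ m - ψ l) ^ 2 := by
        refine Finset.sum_le_sum fun i _ => ?_
        rw [Real.norm_eq_abs, sq_abs]
        nlinarith [hm i, hl i]
    _ = N * (ψ m - ψ l) ^ 2 := by simp

end Kantorovich

/-! ### Gradient of the regularized functional. -/

section Regularized

variable {E : Type*} [NormedAddCommGroup E] [InnerProductSpace ℝ E] [CompleteSpace E]

theorem hasGradientAt_regularized {F : E → ℝ} {g : E → E} {K : ℝ≥0}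
    (hg : LipschitzWith K g) (hF : ∀ x z, F z ≤ F x + inner ℝ (g x) (z - x)) (γ : ℝ) (x : E) :
    HasGradientAt (fun x => F x - γ / 2 * ‖x‖ ^ 2) (g x - γ • x) x := by
  have h1 := (hasGradientAt_of_supergradient hg hF x).hasFDerivAt.sub
    (((hasStrictFDerivAt_norm_sq x).hasFDerivAt).const_mul (γ / 2))
  refine h1.congr_fderiv ?_
  ext v
  simp
  ring

end Regularized

end SemiDiscreteOT

/-! ### The main theorem. -/

theorem proposition5p3 {n N : ℕ} (hn : 2 ≤ n) (hN : 2 ≤ N)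
    (X : Set (EuclideanSpace ℝ (Fin n))) (hX : IsCompact X)
    (y : Fin N → EuclideanSpace ℝ (Fin n)) (hy : Function.Injective y)
    (c : EuclideanSpace ℝ (Fin n) → EuclideanSpace ℝ (Fin n) → ℝ)
    (hreg : SemiDiscreteOT.CostRegular X c y)
    (htwist : SemiDiscreteOT.CostTwist X c y)
    (L : ∀ i, SemiDiscreteOT.LoeperChart X c y i)
    (hconv : SemiDiscreteOT.CConvex L)
    -- the source measure, with a Hölder continuous density on `X`
    (μ : Measure (EuclideanSpace ℝ (Fin n))) [IsProbabilityMeasure μ]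
    (ρ : EuclideanSpace ℝ (Fin n) → ℝ) (hρ0 : ∀ x ∈ X, 0 ≤ ρ x)
    (hμ : μ = (volume.restrict X).withDensity fun x => ENNReal.ofReal (ρ x))
    (α K : ℝ≥0) (hα0 : 0 < α) (hα1 : α ≤ 1) (hρ : HolderOnWith K α ρ X)
    -- the target weights
    (w : EuclideanSpace ℝ (Fin N)) (hw0 : ∀ i, 0 ≤ w i) (hw1 : ∑ i, w i = 1)
    (γ : ℝ) (hγ : 0 < γ) (hγw : γ < (⨅ i, w i) / SemiDiscreteOT.oscBound X c y) :
    (∃ C : ℝ≥0, LipschitzWith C (SemiDiscreteOT.cellMass X c y μ)) ∧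
    Differentiable ℝ (SemiDiscreteOT.regKantorovich X c y μ w γ) ∧
    ∃ ψs : EuclideanSpace ℝ (Fin N),
      -- `ψs` is the unique maximizer of the regularized functional
      (∀ ψ, (∀ φ, SemiDiscreteOT.regKantorovich X c y μ w γ φ ≤
        SemiDiscreteOT.regKantorovich X c y μ w γ ψ) ↔ ψ = ψs) ∧
      ∀ CL : ℝ≥0, LipschitzWith CL (SemiDiscreteOT.cellMass X c y μ) →
        ∀ Q h : ℝ, Q = (CL + γ) / γ → h = 2 / (CL + 2 * γ) →
        ∀ (ψ₀ : EuclideanSpace ℝ (Fin N)) (k : ℕ),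
          ‖SemiDiscreteOT.gradientAscent (SemiDiscreteOT.regKantorovich X c y μ w γ) h ψ₀ k - ψs‖
            ≤ ((Q - 1) / (Q + 1)) ^ k * (SemiDiscreteOT.oscBound X c y + ‖ψ₀‖) ∧
          ‖∇ (SemiDiscreteOT.regKantorovich X c y μ w γ)
              (SemiDiscreteOT.gradientAscent (SemiDiscreteOT.regKantorovich X c y μ w γ) h ψ₀ k)‖
            ≤ (CL + γ) * ((Q - 1) / (Q + 1)) ^ k * (SemiDiscreteOT.oscBound X c y + ‖ψ₀‖) := by
  have hN0 : 0 < N := by omega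
  have hc : ∀ i, ContinuousOn (fun x => c x (y i)) X := fun i => (hreg i).continuousOn
  have hμX : ∀ᵐ x ∂μ, x ∈ X := by
    have hac : μ ≪ volume.restrict X := hμ ▸ withDensity_absolutelyContinuous _ _
    exact hac.ae_le (ae_restrict_mem hX.measurableSet)
  obtain ⟨C, hC0, hC⟩ :=
    SemiDiscreteOT.exists_slabBound hX hreg htwist L μ ρ hμ (hρ.continuousOn hα0)
  obtain ⟨K₀, hK₀⟩ := SemiDiscreteOT.exists_lipschitzWith_cellMass hX hc hC0 hC
  set G := SemiDiscreteOT.cellMass X c y μ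
  set Φ := SemiDiscreteOT.kantorovich X c y μ w
  have hF : ∀ ψ φ, Φ φ ≤ Φ ψ + inner ℝ (G ψ - w) (φ - ψ) :=
    SemiDiscreteOT.kantorovich_le hN0 hX hc hC hμX w
  have hLip : ∀ K : ℝ≥0, LipschitzWith K G → LipschitzWith K fun ψ => G ψ - w := fun K hK => by
    simpa using hK.sub (LipschitzWith.const w)
  have hgrad : ∀ ψ, HasGradientAt (SemiDiscreteOT.regKantorovich X c y μ w γ)
      (G ψ - w - γ • ψ) ψ :=
    SemiDiscreteOT.hasGradientAt_regularized (hLip K₀ hK₀) hF γ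
  refine ⟨⟨K₀, hK₀⟩, fun ψ => (hgrad ψ).differentiableAt, ?_⟩
  obtain ⟨ψs, hψs⟩ := SemiDiscreteOT.exists_eq_smul_of_supergradient (hLip K₀ hK₀) hF hγ
  have hgrowth := SemiDiscreteOT.regularized_le_of_supergradient hF hψs
  have hosc0 : 0 ≤ SemiDiscreteOT.oscBound X c y := by
    have : X.Nonempty := hμX.exists
    obtain ⟨x, hx⟩ := this
    simpa using SemiDiscreteOT.sqrt_mul_sub_le_oscBound hX hc hx ⟨0, hN0⟩ ⟨0, hN0⟩
  -- As M₀ ≥ 0, a nonpositive minimal weight would make the upper bound on γ nonpositive.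
  have hwpos : ∀ i, 0 < w i := by
    have h1 : 0 < ⨅ i, w i := by
      by_contra! h
      linarith [div_nonpos_of_nonpos_of_nonneg h hosc0]
    exact fun i => h1.trans_le (ciInf_le (Set.finite_range _).bddBelow i)
  have hbound : ‖ψs‖ ≤ SemiDiscreteOT.oscBound X c y :=
    SemiDiscreteOT.norm_le_oscBound hN0 hX hc hC hμX hwpos hw1 hγ hψs
  refine ⟨ψs, fun ψ => ⟨fun h => ?_, ?_⟩, ?_⟩
  · have h1 := hgrowth ψ
    have h2 : Φ ψs - γ / 2 * ‖ψs‖ ^ 2 ≤ Φ ψ - γ / 2 * ‖ψ‖ ^ 2 := h ψs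
    have h3 : γ / 2 * ‖ψ - ψs‖ ^ 2 ≤ 0 := by linarith
    have h4 : ‖ψ - ψs‖ ^ 2 ≤ 0 := nonpos_of_mul_nonpos_right h3 (half_pos hγ)
    exact sub_eq_zero.1 (norm_eq_zero.1 (pow_eq_zero_iff two_ne_zero |>.1
      (le_antisymm h4 (sq_nonneg _))))
  · rintro rfl φ
    have : 0 ≤ γ / 2 * ‖φ - ψ‖ ^ 2 := by positivity
    have h1 : Φ φ - γ / 2 * ‖φ‖ ^ 2 ≤ Φ ψ - γ / 2 * ‖ψ‖ ^ 2 := by linarith [hgrowth φ]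
    exact h1
  intro K hK Q h hQ hh ψ₀ k
  have hK0 := K.coe_nonneg
  have hrate : (Q - 1) / (Q + 1) = K / (K + 2 * γ) := by
    rw [hQ]; field_simp; ring
  rw [hrate]
  set a := SemiDiscreteOT.gradientAscent (SemiDiscreteOT.regKantorovich X c y μ w γ) h ψ₀
  have hstep : ∀ k, a (k + 1) = a k + h • (G (a k) - w - γ • a k) := fun k => by
    rw [← (hgrad (a k)).gradient]; rfl
  have hdist : ∀ k, ‖a k - ψs‖
      ≤ (K / (K + 2 * γ)) ^ k * (SemiDiscreteOT.oscBound X c y + ‖ψ₀‖) := by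
    intro k
    induction k with
    | zero =>
      have : ‖a 0 - ψs‖ ≤ ‖ψ₀‖ + ‖ψs‖ := norm_sub_le _ _
      rw [pow_zero, one_mul]
      linarith
    | succ k ih =>
      -- The step fixes `ψs`, so contraction towards it is contraction of the error.
      have h1 := SemiDiscreteOT.norm_ascent_step_sub_le (hLip K hK) hF hγ (a k) ψs
      rw [hψs, sub_self, smul_zero, add_zero, ← hh, ← hstep] at h1
      rw [pow_succ', mul_assoc]
      exact h1.trans (by gcongr)
  refine ⟨hdist k, ?_⟩
  rw [(hgrad (a k)).gradient, mul_assoc]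
  refine le_trans ?_ (mul_le_mul_of_nonneg_left (hdist k) (by positivity))
  -- The gradient vanishes at `ψs`; subtracting it leaves a difference of gradients, controlled by K
  -- + γ.
  have e : G (a k) - w - γ • a k = (G (a k) - G ψs) - γ • (a k - ψs) := by
    rw [smul_sub, ← hψs]; abel
  rw [e, add_mul]
  refine (norm_sub_le _ _).trans (add_le_add (hK.norm_sub_le _ _) ?_)
  rw [norm_smul, Real.norm_of_nonneg hγ.le]
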